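/- Let $n \ge 0$ and let $x \in \{0,1\}^n$ be a bit string of Hamming weight $k \le \lfloor n/2 \rfloor$. For a partition $\lambda$ of $n$ let $V_\lambda$ be the irreducible complex representation of $S_n$ labelled by $\lambda$ (the Specht module), with dimension $d_\lambda$ and character $\chi_\lambda$, and let $D$ be the representation of $S_n$ on $(\mathbb{C}^2)^{\otimes n}$ given by $D(\pi)|i_1\rangle\cdots|i_n\rangle = |i_{\pi^{-1}(1)}\rangle\cdots|i_{\pi^{-1}(n)}\rangle$. Weak Schur sampling on the computational basis state $|x\rangle$ yields the outcome $\lambda$ with probability $\operatorname{tr}(P_\lambda |x\rangle\langle x|)$, where $$P_\lambda = \frac{d_\lambda}{n!}\sum_{\pi\in S_n}\chi_\lambda(\pi)D(\pi).$$ For $0 \le \ell \le \lfloor n/2\rfloor$ let $\Pr[\ell\,|\,k]$ be the probability of the outcome $\lambda = (n-\ell,\ell)$. Then $\Pr[\ell\,|\,k] = 0$ if $\ell > k$, and $$\Pr[\ell\,|\,k] = \frac{\binom{n}{\ell}-\binom{n}{\ell-1}}{\binom{n}{k}}$$ if $\ell \le k$, where $\binom{n}{-1} = 0$. In particular, $\sum_{\ell=0}^{k}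 \Pr[\ell\,|\,k] = 1$. -/

import Mathlib

open scoped BigOperators

namespace WeakSchur

noncomputable section

/-- The representation of `S_n` by permutation of the `n` tensor factors of `(ℂ^α)^{⊗ n}`, a vector
being given by its coordinates in the basis `|i_1 … i_n⟩`, `i : Fin n → α`. The coordinate of
`D(π) v` at `j` is the coordinate of `v` at `j ∘ π`, i.e. `D(π) |i⟩ = |i ∘ π⁻¹⟩`. -/
def permRep (n : ℕ) (α : Type) :
    Representation ℂ (Equiv.Perm (Fin n)) ((Fin n → α) → ℂ) where
  toFun π := LinearMap.funLeft ℂ ℂ (fun j : Fin n → α => j ∘ π)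
  map_one' := rfl
  map_mul' _ _ := rfl

/-- The defining formula on basis vectors: `D(π) |i_1 … i_n⟩ = |i_{π⁻¹(1)} … i_{π⁻¹(n)}⟩`. -/
theorem permRep_single {n : ℕ} {α : Type} [DecidableEq α] (π : Equiv.Perm (Fin n))
    (i : Fin n → α) :
    permRep n α π (Pi.single i 1) = Pi.single (fun m => i (π⁻¹ m)) 1 := by
  funext j
  have h : (j ∘ π = i) ↔ (j = fun m => i (π⁻¹ m)) := by
    constructor
    · rintro rfl
      funext m
      simp
    · rintro rfl
      funext m
      simp
  change (Pi.single i 1 : (Fin n → α) → ℂ) (j ∘ π) = _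
  simp only [Pi.single_apply, h]

/-- Partitions of `n`, as Young diagrams with `n` boxes; a box is a pair (row, column). -/
abbrev Shape (n : ℕ) : Type := {μ : YoungDiagram // μ.card = n}

/-- Young tableaux of shape `μ`: bijective fillings of the boxes by `Fin n`, given by the map that
sends an entry to its box. -/
abbrev Tableau {n : ℕ} (μ : Shape n) : Type := Fin n ≃ μ.1.cells

/-- The row of the tableau `t` that contains the entry `i`. The function `t.row` is the tabloid of
`t`, i.e. the class of `t` up to permutations within its rows. -/
def Tableau.row {n : ℕ} {μ : Shape n} (t : Tableau μ) (i : Fin n) : ℕ := (t i).1.1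

/-- The column of the tableau `t` that contains the entry `i`. -/
def Tableau.col {n : ℕ} {μ : Shape n} (t : Tableau μ) (i : Fin n) : ℕ := (t i).1.2

/-- The polytabloid of `t`: the sum of `sign(π) π·{t}` over the `π` that preserve every column
of `t`. Tabloids are basis vectors `|r⟩`, with `r : Fin n → ℕ` the row function. -/
def polytabloid {n : ℕ} {μ : Shape n} (t : Tableau μ) : (Fin n → ℕ) → ℂ :=
  ∑ π : Equiv.Perm (Fin n) with ∀ i, t.col (π i) = t.col i,
    ((Equiv.Perm.sign π : ℤ) : ℂ) • permRep n ℕ π (Pi.single t.row 1)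

/-- The space of the Specht module: the span of all polytabloids of shape `μ`. -/
def spechtSpace {n : ℕ} (μ : Shape n) : Submodule ℂ ((Fin n → ℕ) → ℂ) :=
  Submodule.span ℂ (Set.range fun t : Tableau μ => polytabloid t)

theorem permRep_polytabloid {n : ℕ} {μ : Shape n} (σ : Equiv.Perm (Fin n)) (t : Tableau μ) :
    permRep n ℕ σ (polytabloid t) = polytabloid (σ⁻¹.trans t : Tableau μ) := by
  unfold polytabloid
  rw [map_sum]
  have hrow : (Pi.single (Tableau.row (σ⁻¹.trans t : Tableau μ)) 1 : (Fin n → ℕ) → ℂ)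
      = permRep n ℕ σ (Pi.single t.row 1) := by
    rw [permRep_single]
    rfl
  refine Finset.sum_equiv (MulAut.conj σ).toEquiv ?_ ?_
  · intro π
    simp only [Finset.mem_filter, Finset.mem_univ, true_and]
    constructor
    · intro h i
      have := h (σ⁻¹ i)
      simpa [Tableau.col] using this
    · intro h i
      have := h (σ i)
      simpa [Tableau.col] using this
  · intro π _
    rw [hrow, map_smul]
    simp only [MulEquiv.toEquiv_eq_coe, MulEquiv.coe_toEquiv, MulAut.conj_apply]
    rw [← Module.End.mul_apply, ← Module.End.mul_apply, ← map_mul, ← map_mul]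
    have hs : Equiv.Perm.sign (σ * π * σ⁻¹) = Equiv.Perm.sign π := by
      rw [map_mul, map_mul, map_inv, mul_right_comm, mul_inv_cancel, one_mul]
    rw [hs, inv_mul_cancel_right]

theorem permRep_mem_spechtSpace {n : ℕ} (μ : Shape n) (σ : Equiv.Perm (Fin n))
    (v : (Fin n → ℕ) → ℂ) (hv : v ∈ spechtSpace μ) : permRep n ℕ σ v ∈ spechtSpace μ := by
  refine Submodule.span_induction (p := fun v _ => permRep n ℕ σ v ∈ spechtSpace μ)
    ?_ ?_ ?_ ?_ hv
  · rintro _ ⟨t, rfl⟩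
    simp only [permRep_polytabloid]
    exact Submodule.subset_span ⟨_, rfl⟩
  · simp
  · intro u w _ _ hu hw
    rw [map_add]
    exact Submodule.add_mem _ hu hw
  · intro c u _ hu
    rw [map_smul]
    exact Submodule.smul_mem _ c hu

/-- The irreducible representation `V_μ` of `S_n` labelled by `μ` (the Specht module). -/
def spechtRep {n : ℕ} (μ : Shape n) :
    Representation ℂ (Equiv.Perm (Fin n)) (spechtSpace μ) where
  toFun σ := (permRep n ℕ σ).restrict (permRep_mem_spechtSpace μ σ)
  map_one' := rfl
  map_mul' _ _ := rfl

/-- The space of `n` qubits, in coordinates with respect to the computational basis. -/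
abbrev Qubits (n : ℕ) : Type := (Fin n → Fin 2) → ℂ

/-- The operator `|x⟩⟨x|` for a bit string `x`. -/
def ketBra {n : ℕ} (x : Fin n → Fin 2) : Qubits n →ₗ[ℂ] Qubits n :=
  LinearMap.single ℂ (fun _ : Fin n → Fin 2 => ℂ) x ∘ₗ LinearMap.proj x

/-- The operator `P_μ = (d_μ / n!) ∑_π χ_μ(π) D(π)` on `n` qubits, where `d_μ` and `χ_μ` are the
dimension and the character of `V_μ`. -/
def schurProjector {n : ℕ} (μ : Shape n) : Qubits n →ₗ[ℂ] Qubits n :=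
  ((Module.finrank ℂ (spechtSpace μ) : ℂ) / (n.factorial : ℂ)) •
    ∑ π : Equiv.Perm (Fin n), (spechtRep μ).character π • permRep n (Fin 2) π

/-- The probability `tr(P_μ ρ)` of the outcome `μ` of weak Schur sampling on the state `ρ`. -/
def outcomeProb {n : ℕ} (μ : Shape n) (ρ : Qubits n →ₗ[ℂ] Qubits n) : ℂ :=
  LinearMap.trace ℂ (Qubits n) (schurProjector μ ∘ₗ ρ)

theorem twoRow_card (a b : ℕ) (h : [a, b].SortedGE) :
    (YoungDiagram.ofRowLens [a, b] h).card = a + b := by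
  have hc : (YoungDiagram.ofRowLens [a, b] h).cells
      = ({0} ×ˢ Finset.range a) ∪ ({1} ×ˢ Finset.range b) := by
    ext ⟨i, j⟩
    rw [YoungDiagram.mem_cells, YoungDiagram.mem_ofRowLens]
    rcases i with _ | _ | i <;> simp
  rw [YoungDiagram.card, hc, Finset.card_union_of_disjoint]
  · simp
  · rw [Finset.disjoint_left]
    rintro ⟨i, j⟩
    simp only [Finset.mem_product, Finset.mem_singleton, Finset.mem_range]
    omega

/-- The partition `(n - ℓ, ℓ)` of `n`, for `ℓ ≤ ⌊n / 2⌋`. -/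
def twoRow (n ℓ : ℕ) (h : ℓ ≤ n / 2) : Shape n :=
  have hs : [n - ℓ, ℓ].SortedGE := by
    apply List.Pairwise.sortedGE
    simp
    omega
  ⟨YoungDiagram.ofRowLens [n - ℓ, ℓ] hs, by rw [twoRow_card]; omega⟩

end

end WeakSchur

/-! The diagonal entry of `D(π)` at `x` is 1 if `π` preserves `x` and 0 otherwise, so the
probability is `d_λ / n!` times the sum of `χ_λ` over the stabilizer of `x` (`outcomeProb_ketBra`).
Both factors are computed in a polynomial model: reading a tabloid as the product of the variables
in its second row turns the Specht module of shape `(n - ℓ, ℓ)` into the span of products of `ℓ`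
differences of distinct variables (`map_bitPoly_spechtSpace`).

The character sum is the trace of the sum of the stabilizer. That operator kills a product having a
factor whose two variables carry equal bits of `x`, since swapping them changes the sign. Up to
sign, the other products form one orbit of the stabilizer. Hence the operator vanishes if `k < ℓ`;
otherwise it is `P ↦ P(x) • w`, with trace `w(x) = k! (n - k)!`.

For the dimension, adjoining a variable to `A` adds to the span for `ℓ + 1` a copy of the span for
`ℓ` (`finrank_pairSpan_insert`), and Pascal's rule gives a difference of binomial coefficients. The
probabilities then telescope to 1. -/

namespace WeakSchur

open MvPolynomial

noncomputable section

/-! ### Spans of products of differences and their dimensions -/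

section PairProducts

variable {σ : Type*}

/-- The product of the differences `X (u j) - X (v j)`, `j < ℓ`. -/
def pairProd {ℓ : ℕ} (u v : Fin ℓ → σ) : MvPolynomial σ ℂ :=
  ∏ j, (X (u j) - X (v j))

/-- The span of the products of `ℓ` differences of variables, the `2 * ℓ` variables being distinct
elements of `A`. -/
def pairSpan (A : Set σ) (ℓ : ℕ) : Submodule ℂ (MvPolynomial σ ℂ) :=
  Submodule.span ℂ {P | ∃ u v : Fin ℓ → σ, Function.Injective (Sum.elim u v) ∧
    (∀ j, u j ∈ A) ∧ (∀ j, v j ∈ A) ∧ P = pairProd u v}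

theorem sumElim_injective_cons {ℓ : ℕ} {u v : Fin ℓ → σ} {a b : σ}
    (h : Function.Injective (Sum.elim u v)) (hab : a ≠ b) (hau : ∀ j, u j ≠ a)
    (hav : ∀ j, v j ≠ a) (hbu : ∀ j, u j ≠ b) (hbv : ∀ j, v j ≠ b) :
    Function.Injective (Sum.elim (Fin.cons a u : Fin (ℓ + 1) → σ) (Fin.cons b v)) := by
  rw [Sum.elim_injective] at h ⊢
  obtain ⟨h1, h2, h3⟩ := h
  refine ⟨?_, ?_, ?_⟩
  · rw [Fin.cons_injective_iff]
    exact ⟨by rintro ⟨j, hj⟩; exact hau j hj, h1⟩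
  · rw [Fin.cons_injective_iff]
    exact ⟨by rintro ⟨j, hj⟩; exact hbv j hj, h2⟩
  · intro i j
    refine Fin.cases ?_ (fun i => ?_) i <;> refine Fin.cases ?_ (fun j => ?_) j
    · simpa using hab
    · simpa using (hav j).symm
    · simpa using hbu i
    · simpa using h3 i j

theorem pairProd_cons {ℓ : ℕ} (u v : Fin ℓ → σ) (a b : σ) :
    pairProd (Fin.cons a u : Fin (ℓ + 1) → σ) (Fin.cons b v) = (X a - X b) * pairProd u v := by
  simp [pairProd, Fin.prod_univ_succ]

theorem pairProd_mem_pairSpan {A : Set σ} {ℓ : ℕ} {u v : Fin ℓ → σ}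
    (h : Function.Injective (Sum.elim u v)) (hu : ∀ j, u j ∈ A) (hv : ∀ j, v j ∈ A) :
    pairProd u v ∈ pairSpan A ℓ :=
  Submodule.subset_span ⟨u, v, h, hu, hv, rfl⟩

theorem pairSpan_mono {A B : Set σ} (h : A ⊆ B) (ℓ : ℕ) : pairSpan A ℓ ≤ pairSpan B ℓ := by
  refine Submodule.span_mono ?_
  rintro _ ⟨u, v, hi, hu, hv, rfl⟩
  exact ⟨u, v, hi, fun j => h (hu j), fun j => h (hv j), rfl⟩

theorem pairSpan_zero (A : Set σ) : pairSpan A 0 = Submodule.span ℂ {1} := by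
  unfold pairSpan
  congr 1
  ext P
  simp only [Set.mem_ofPred_eq, Set.mem_singleton_iff]
  constructor
  · rintro ⟨u, v, -, -, -, rfl⟩
    simp [pairProd]
  · rintro rfl
    exact ⟨Fin.elim0, Fin.elim0, fun i => by rcases i with i | i <;> exact i.elim0,
      fun j => j.elim0, fun j => j.elim0, by simp [pairProd]⟩

theorem two_mul_le_card {A : Finset σ} {ℓ : ℕ} {u v : Fin ℓ → σ}
    (h : Function.Injective (Sum.elim u v)) (hu : ∀ j, u j ∈ A) (hv : ∀ j, v j ∈ A) :
    2 * ℓ ≤ A.card := by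
  have := Finset.card_le_card_of_injOn (s := Finset.univ) (t := A) (Sum.elim u v)
    (by rintro (i | i) - <;> simp [hu, hv]) h.injOn
  simp at this
  omega

theorem pairSpan_eq_bot {A : Finset σ} {ℓ : ℕ} (h : A.card < 2 * ℓ) :
    pairSpan (A : Set σ) ℓ = ⊥ := by
  unfold pairSpan
  rw [Submodule.span_eq_bot]
  rintro _ ⟨u, v, hi, hu, hv, rfl⟩
  exact absurd (two_mul_le_card hi hu hv) (by omega)

instance pairSpan_finiteDimensional [Finite σ] (A : Set σ) (ℓ : ℕ) :
    FiniteDimensional ℂ (pairSpan A ℓ) := by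
  refine FiniteDimensional.span_of_finite ℂ ?_
  refine (Set.finite_range fun p : (Fin ℓ → σ) × (Fin ℓ → σ) => pairProd p.1 p.2).subset ?_
  rintro _ ⟨u, v, -, -, -, rfl⟩
  exact ⟨(u, v), rfl⟩

/-- The derivation of `ℂ[X]` that maps every variable to its square. -/
def squareDerivation (σ : Type*) : Derivation ℂ (MvPolynomial σ ℂ) (MvPolynomial σ ℂ) :=
  mkDerivation ℂ fun i => X i ^ 2

/-- Each factor is an eigenvector up to a polynomial, as `a² - b² = (a + b)(a - b)`; the Leibniz
rule adds up the cofactors. -/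
theorem squareDerivation_pairProd {ℓ : ℕ} (u v : Fin ℓ → σ) :
    squareDerivation σ (pairProd u v) = (∑ j, (X (u j) + X (v j))) * pairProd u v := by
  induction ℓ with
  | zero => simp [pairProd]
  | succ ℓ ih =>
    have h := ih (Fin.tail u) (Fin.tail v)
    rw [← Fin.cons_self_tail u, ← Fin.cons_self_tail v, pairProd_cons, Derivation.leibniz, h,
      Fin.sum_univ_succ]
    simp only [squareDerivation, map_sub, mkDerivation_X, smul_eq_mul, Fin.cons_zero, Fin.cons_succ]
    ring

/-- Multiplication by the sum of the variables in `A`, squares of variables being replaced by `0`. -/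
def raise (A : Finset σ) : MvPolynomial σ ℂ →ₗ[ℂ] MvPolynomial σ ℂ :=
  LinearMap.mulLeft ℂ (∑ b ∈ A, X b) - (squareDerivation σ : _ →ₗ[ℂ] _)

theorem pairProd_eq_mul_succAbove {ℓ : ℕ} (u v : Fin (ℓ + 1) → σ) (i : Fin (ℓ + 1)) :
    pairProd u v = (X (u i) - X (v i)) * pairProd (u ∘ i.succAbove) (v ∘ i.succAbove) := by
  simp [pairProd, Fin.prod_univ_succAbove _ i]

theorem pderiv_pairProd {ℓ : ℕ} {u v : Fin ℓ → σ} {a : σ} (hu : ∀ j, u j ≠ a)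
    (hv : ∀ j, v j ≠ a) : pderiv a (pairProd u v) = 0 := by
  induction ℓ with
  | zero => simp [pairProd]
  | succ ℓ ih =>
    have h := ih (u := Fin.tail u) (v := Fin.tail v) (fun j => hu _) (fun j => hv _)
    rw [← Fin.cons_self_tail u, ← Fin.cons_self_tail v, pairProd_cons, Derivation.leibniz, h,
      map_sub, pderiv_X_of_ne (hu 0), pderiv_X_of_ne (hv 0)]
    simp

theorem pderiv_eq_zero_of_mem_pairSpan {A : Set σ} {a : σ} (ha : a ∉ A) {ℓ : ℕ}
    {P : MvPolynomial σ ℂ} (hP : P ∈ pairSpan A ℓ) : pderiv a P = 0 := by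
  have : pairSpan A ℓ ≤ LinearMap.ker (pderiv a : Derivation ℂ (MvPolynomial σ ℂ) (MvPolynomial σ ℂ)).toLinearMap := by
    refine Submodule.span_le.mpr ?_
    rintro _ ⟨u, v, hi, hu, hv, rfl⟩
    exact pderiv_pairProd (fun j h => ha (h ▸ hu j)) (fun j h => ha (h ▸ hv j))
  exact this hP

theorem finrank_pairSpan_zero (A : Set σ) : Module.finrank ℂ (pairSpan A 0) = 1 := by
  rw [pairSpan_zero]
  exact finrank_span_singleton one_ne_zero

variable [DecidableEq σ]

/-- The variables occurring in `pairProd u v`. -/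
def pairSupport {ℓ : ℕ} (u v : Fin ℓ → σ) : Finset σ := Finset.univ.image (Sum.elim u v)

theorem mem_pairSupport {ℓ : ℕ} {u v : Fin ℓ → σ} {a : σ} :
    a ∈ pairSupport u v ↔ (∃ j, u j = a) ∨ ∃ j, v j = a := by
  simp [pairSupport]

theorem card_pairSupport {ℓ : ℕ} {u v : Fin ℓ → σ} (h : Function.Injective (Sum.elim u v)) :
    (pairSupport u v).card = 2 * ℓ := by
  rw [pairSupport, Finset.card_image_of_injective _ h]
  simp
  omega

theorem pairSupport_subset {A : Finset σ} {ℓ : ℕ} {u v : Fin ℓ → σ} (hu : ∀ j, u j ∈ A)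
    (hv : ∀ j, v j ∈ A) : pairSupport u v ⊆ A := by
  intro a ha
  rw [mem_pairSupport] at ha
  rcases ha with ⟨j, rfl⟩ | ⟨j, rfl⟩
  exacts [hu j, hv j]

/-- The derivation removes exactly the variables already used. This makes a multiplier that depends
on `u` and `v` into one linear operator on the whole span. -/
theorem raise_pairProd {A : Finset σ} {ℓ : ℕ} {u v : Fin ℓ → σ}
    (h : Function.Injective (Sum.elim u v)) (hu : ∀ j, u j ∈ A) (hv : ∀ j, v j ∈ A) :
    raise A (pairProd u v) = (∑ b ∈ A \ pairSupport u v, X b) * pairProd u v := by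
  have hs : (∑ b ∈ pairSupport u v, X b : MvPolynomial σ ℂ) = ∑ j, (X (u j) + X (v j)) := by
    rw [pairSupport, Finset.sum_image h.injOn, Fintype.sum_sum_type, Finset.sum_add_distrib]
    simp
  have h1 : raise A (pairProd u v) = (∑ b ∈ A, X b) * pairProd u v
      - squareDerivation σ (pairProd u v) := rfl
  rw [h1, squareDerivation_pairProd, ← hs, ← Finset.sum_sdiff (pairSupport_subset hu hv)]
  ring

/-- A linear lift of `pairSpan A ℓ` to `pairSpan (insert a A) (ℓ + 1)`. -/
def lift (A : Finset σ) (a : σ) (ℓ : ℕ) : MvPolynomial σ ℂ →ₗ[ℂ] MvPolynomial σ ℂ :=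
  LinearMap.mulLeft ℂ (X a) - ((A.card : ℂ) - 2 * ℓ)⁻¹ • raise A

/-- The lift of a product is the average of `(X a - X c) * pairProd u v` over the `|A| - 2ℓ` unused
`c`; average `X a - X b = (X a - X c) + (X c - X b)`. -/
theorem lift_pairProd_add {A : Finset σ} {a b : σ} {ℓ : ℕ} {u v : Fin ℓ → σ}
    (h : Function.Injective (Sum.elim u v)) (hu : ∀ j, u j ∈ A) (hv : ∀ j, v j ∈ A)
    (hb : b ∈ A \ pairSupport u v) :
    (X a - X b) * pairProd u v = lift A a ℓ (pairProd u v) +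
      ((A.card : ℂ) - 2 * ℓ)⁻¹ • ∑ c ∈ A \ pairSupport u v, (X c - X b) * pairProd u v := by
  have hcard : ((A \ pairSupport u v).card : ℂ) = (A.card : ℂ) - 2 * ℓ := by
    rw [Finset.card_sdiff_of_subset (pairSupport_subset hu hv), card_pairSupport h,
      Nat.cast_sub (two_mul_le_card h hu hv)]
    simp
  have hne : (A.card : ℂ) - 2 * ℓ ≠ 0 := by
    rw [← hcard]
    exact_mod_cast (Finset.card_pos.mpr ⟨b, hb⟩).ne'
  have h1 : lift A a ℓ (pairProd u v) = X a * pairProd u v -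
    ((A.card : ℂ) - 2 * ℓ)⁻¹ • raise A (pairProd u v) := rfl
  rw [h1, raise_pairProd h hu hv, ← Finset.sum_mul, Finset.sum_sub_distrib, Finset.sum_const,
    sub_mul (∑ _ ∈ _, _), smul_sub, ← Nat.cast_smul_eq_nsmul ℂ, hcard, smul_mul_assoc, smul_smul,
    inv_mul_cancel₀ hne, one_smul]
  ring

theorem sub_mul_pairProd_mem {A : Finset σ} {b c : σ} {ℓ : ℕ} {u v : Fin ℓ → σ}
    (h : Function.Injective (Sum.elim u v)) (hu : ∀ j, u j ∈ A) (hv : ∀ j, v j ∈ A)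
    (hb : b ∈ A \ pairSupport u v) (hc : c ∈ A \ pairSupport u v) :
    (X c - X b) * pairProd u v ∈ pairSpan (A : Set σ) (ℓ + 1) := by
  by_cases hcb : c = b
  · simp [hcb]
  rw [Finset.mem_sdiff, mem_pairSupport] at hb hc
  push Not at hb hc
  rw [← pairProd_cons]
  refine pairProd_mem_pairSpan (sumElim_injective_cons h hcb hc.2.1 hc.2.2 hb.2.1 hb.2.2) ?_ ?_
  · exact Fin.cases (by simpa using hc.1) (by simpa using hu)
  · exact Fin.cases (by simpa using hb.1) (by simpa using hv)

theorem sub_mul_pairProd_mem_sup {A : Finset σ} {a b : σ} {ℓ : ℕ} {u v : Fin ℓ → σ}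
    (h : Function.Injective (Sum.elim u v)) (hu : ∀ j, u j ∈ A) (hv : ∀ j, v j ∈ A)
    (hb : b ∈ A \ pairSupport u v) :
    (X a - X b) * pairProd u v ∈
      pairSpan (A : Set σ) (ℓ + 1) ⊔ (pairSpan (A : Set σ) ℓ).map (lift A a ℓ) := by
  rw [lift_pairProd_add h hu hv hb, sup_comm]
  have h1 : ∑ c ∈ A \ pairSupport u v, (X c - X b) * pairProd u v ∈
      pairSpan (A : Set σ) (ℓ + 1) :=
    Submodule.sum_mem _ fun c hc => sub_mul_pairProd_mem h hu hv hb hc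
  have h2 : pairProd u v ∈ pairSpan (A : Set σ) ℓ := pairProd_mem_pairSpan h hu hv
  exact Submodule.add_mem_sup (Submodule.mem_map_of_mem h2) (Submodule.smul_mem _ _ h1)

/-- The variable `a` occurs in at most one factor; split off that factor, with a sign if `a` is its
second variable. -/
theorem pairSpan_insert_le (A : Finset σ) (a : σ) (ℓ : ℕ) :
    pairSpan ((insert a A : Finset σ) : Set σ) (ℓ + 1) ≤
      pairSpan (A : Set σ) (ℓ + 1) ⊔ (pairSpan (A : Set σ) ℓ).map (lift A a ℓ) := by
  refine Submodule.span_le.mpr ?_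
  rintro _ ⟨u, v, hi, hu, hv, rfl⟩
  have hi' := hi
  rw [Sum.elim_injective] at hi'
  obtain ⟨h1, h2, h3⟩ := hi'
  simp only [Finset.mem_coe, Finset.mem_insert] at hu hv
  have hrest (i : Fin (ℓ + 1)) :
      Function.Injective (Sum.elim (u ∘ i.succAbove) (v ∘ i.succAbove)) := by
    rw [Sum.elim_injective]
    exact ⟨h1.comp Fin.succAbove_right_injective, h2.comp Fin.succAbove_right_injective,
      fun _ _ => h3 _ _⟩
  by_cases hua : ∃ i, u i = a
  · obtain ⟨i, hia⟩ := hua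
    rw [pairProd_eq_mul_succAbove u v i, hia]
    refine sub_mul_pairProd_mem_sup (hrest i) (fun j => ?_) (fun j => ?_) ?_
    · refine (hu _).resolve_left fun h => ?_
      exact Fin.succAbove_ne i j (h1 (h.trans hia.symm))
    · exact (hv _).resolve_left fun h => h3 i _ (hia.trans h.symm)
    · rw [Finset.mem_sdiff, mem_pairSupport]
      refine ⟨(hv i).resolve_left fun h => h3 i i (hia.trans h.symm), ?_⟩
      rintro (⟨j, hj⟩ | ⟨j, hj⟩)
      · exact h3 _ _ hj
      · exact Fin.succAbove_ne i j (h2 hj)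
  by_cases hva : ∃ i, v i = a
  · obtain ⟨i, hia⟩ := hva
    rw [pairProd_eq_mul_succAbove u v i, hia, ← neg_sub, neg_mul]
    refine Submodule.neg_mem _ (sub_mul_pairProd_mem_sup (hrest i) (fun j => ?_) (fun j => ?_) ?_)
    · exact (hu _).resolve_left fun h => h3 _ i (h.trans hia.symm)
    · refine (hv _).resolve_left fun h => ?_
      exact Fin.succAbove_ne i j (h2 (h.trans hia.symm))
    · rw [Finset.mem_sdiff, mem_pairSupport]
      refine ⟨(hu i).resolve_left fun h => h3 i i (h.trans hia.symm), ?_⟩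
      rintro (⟨j, hj⟩ | ⟨j, hj⟩)
      · exact Fin.succAbove_ne i j (h1 hj)
      · exact h3 _ _ hj.symm
  push Not at hua hva
  exact Submodule.mem_sup_left (pairProd_mem_pairSpan hi
    (fun j => (hu j).resolve_left (hua j)) (fun j => (hv j).resolve_left (hva j)))

theorem lift_mem_pairSpan {A : Finset σ} {a : σ} (ha : a ∉ A) {ℓ : ℕ} (hℓ : 2 * ℓ < A.card) :
    (pairSpan (A : Set σ) ℓ).map (lift A a ℓ) ≤
      pairSpan ((insert a A : Finset σ) : Set σ) (ℓ + 1) := by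
  rw [pairSpan, Submodule.map_span, Submodule.span_le]
  rintro _ ⟨_, ⟨u, v, hi, hu, hv, rfl⟩, rfl⟩
  obtain ⟨b, hb⟩ : (A \ pairSupport u v).Nonempty := by
    rw [← Finset.card_pos, Finset.card_sdiff_of_subset (pairSupport_subset hu hv),
      card_pairSupport hi]
    omega
  have hmem : ∀ c ∈ insert a (A \ pairSupport u v), c ∈ insert a A \ pairSupport u v := by
    intro c hc
    rw [Finset.mem_insert] at hc
    rcases hc with rfl | hc
    · exact Finset.mem_sdiff.mpr ⟨Finset.mem_insert_self _ _,
        fun h => ha (pairSupport_subset hu hv h)⟩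
    · rw [Finset.mem_sdiff] at hc
      exact Finset.mem_sdiff.mpr ⟨Finset.mem_insert_of_mem hc.1, hc.2⟩
  have key : ∀ c ∈ insert a (A \ pairSupport u v),
      (X c - X b) * pairProd u v ∈ pairSpan ((insert a A : Finset σ) : Set σ) (ℓ + 1) :=
    fun c hc => sub_mul_pairProd_mem hi (fun j => Finset.mem_insert_of_mem (hu j))
      (fun j => Finset.mem_insert_of_mem (hv j)) (hmem b (Finset.mem_insert_of_mem hb)) (hmem c hc)
  change lift A a ℓ (pairProd u v) ∈ _
  rw [eq_sub_iff_add_eq.mpr (lift_pairProd_add (a := a) hi hu hv hb).symm]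
  exact Submodule.sub_mem _ (key a (Finset.mem_insert_self _ _)) (Submodule.smul_mem _ _
    (Submodule.sum_mem _ fun c hc => key c (Finset.mem_insert_of_mem hc)))

theorem pairSpan_insert {A : Finset σ} {a : σ} (ha : a ∉ A) {ℓ : ℕ} (hℓ : 2 * ℓ < A.card) :
    pairSpan ((insert a A : Finset σ) : Set σ) (ℓ + 1) =
      pairSpan (A : Set σ) (ℓ + 1) ⊔ (pairSpan (A : Set σ) ℓ).map (lift A a ℓ) :=
  le_antisymm (pairSpan_insert_le A a ℓ) (sup_le
    (pairSpan_mono (by simp) _) (lift_mem_pairSpan ha hℓ))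

/-- Only the term `X a * P` involves `a`. This left inverse yields both the injectivity of the lift
and the directness of the sum. -/
theorem pderiv_lift {A : Finset σ} {a : σ} (ha : a ∉ A) {ℓ : ℕ} {P : MvPolynomial σ ℂ}
    (hP : P ∈ pairSpan (A : Set σ) ℓ) : pderiv a (lift A a ℓ P) = P := by
  refine LinearMap.eqOn_span (f := (pderiv a : Derivation ℂ (MvPolynomial σ ℂ) (MvPolynomial σ ℂ)).toLinearMap ∘ₗ lift A a ℓ)
    (g := LinearMap.id) ?_ hP
  rintro _ ⟨u, v, hi, hu, hv, rfl⟩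
  have h0 : pderiv a (pairProd u v) = 0 :=
    pderiv_pairProd (fun j h => ha (h ▸ hu j)) (fun j h => ha (h ▸ hv j))
  have h1 : lift A a ℓ (pairProd u v) = X a * pairProd u v -
    ((A.card : ℂ) - 2 * ℓ)⁻¹ • raise A (pairProd u v) := rfl
  have h2 : pderiv a (∑ b ∈ A \ pairSupport u v, X b : MvPolynomial σ ℂ) = 0 := by
    rw [map_sum]
    refine Finset.sum_eq_zero fun b hb => pderiv_X_of_ne ?_
    rintro rfl
    exact ha (Finset.mem_sdiff.mp hb).1
  change pderiv a (lift A a ℓ (pairProd u v)) = pairProd u v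
  rw [h1, raise_pairProd hi hu hv, map_sub, Derivation.map_smul, Derivation.leibniz,
    Derivation.leibniz, h0, h2, pderiv_X_self]
  simp

theorem finrank_pairSpan_insert [Finite σ] {A : Finset σ} {a : σ} (ha : a ∉ A) {ℓ : ℕ}
    (hℓ : 2 * ℓ < A.card) :
    Module.finrank ℂ (pairSpan ((insert a A : Finset σ) : Set σ) (ℓ + 1)) =
      Module.finrank ℂ (pairSpan (A : Set σ) (ℓ + 1)) +
        Module.finrank ℂ (pairSpan (A : Set σ) ℓ) := by
  have hinf : pairSpan (A : Set σ) (ℓ + 1) ⊓ (pairSpan (A : Set σ) ℓ).map (lift A a ℓ) = ⊥ := by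
    rw [eq_bot_iff]
    rintro _ ⟨h1, P, hP, rfl⟩
    have h2 := pderiv_lift ha hP
    rw [pderiv_eq_zero_of_mem_pairSpan (by simpa using ha) h1] at h2
    simp [← h2]
  have hmap : Module.finrank ℂ ((pairSpan (A : Set σ) ℓ).map (lift A a ℓ)) =
      Module.finrank ℂ (pairSpan (A : Set σ) ℓ) := by
    rw [← LinearMap.range_domRestrict]
    refine LinearMap.finrank_range_of_inj ?_
    rintro ⟨P, hP⟩ ⟨Q, hQ⟩ h
    change lift A a ℓ P = lift A a ℓ Q at h
    rw [Subtype.mk.injEq, ← pderiv_lift ha hP, ← pderiv_lift ha hQ, h]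
  have h := Submodule.finrank_sup_add_finrank_inf_eq (pairSpan (A : Set σ) (ℓ + 1))
    ((pairSpan (A : Set σ) ℓ).map (lift A a ℓ))
  rw [hinf, finrank_bot, add_zero, hmap] at h
  rw [pairSpan_insert ha hℓ, h]

theorem finrank_pairSpan_succ [Finite σ] (A : Finset σ) (ℓ : ℕ) (h : 2 * ℓ + 2 ≤ A.card + 1) :
    Module.finrank ℂ (pairSpan (A : Set σ) (ℓ + 1)) + A.card.choose ℓ =
      A.card.choose (ℓ + 1) := by
  induction A using Finset.induction_on generalizing ℓ with
  | empty => simp at h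
  | insert a A ha ih =>
    rw [Finset.card_insert_of_notMem ha] at h ⊢
    rcases Nat.lt_or_ge A.card (2 * ℓ + 1) with hlt | hge
    -- The boundary case: `2ℓ + 1` variables are too few for `ℓ + 1` pairs, and the two middle
    -- binomial coefficients agree.
    · have hc : A.card = 2 * ℓ := by omega
      rw [pairSpan_eq_bot (by rw [Finset.card_insert_of_notMem ha]; omega), finrank_bot, hc,
        zero_add, ← Nat.choose_symm_half]
    · rw [finrank_pairSpan_insert ha (by omega)]
      have h1 := ih ℓ (by omega)
      rcases ℓ with _ | ℓ
      · rw [finrank_pairSpan_zero]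
        simp at h1 ⊢
        omega
      · have h2 := ih ℓ (by omega)
        rw [Nat.choose_succ_succ' A.card ℓ, Nat.choose_succ_succ' A.card (ℓ + 1)]
        omega

end PairProducts

/-! ### Symmetrization over the stabilizer of a bit string -/

section OrbitSum

variable {σ : Type*}

theorem rename_pairProd {τ : Type*} (f : σ → τ) {ℓ : ℕ} (u v : Fin ℓ → σ) :
    rename f (pairProd u v) = pairProd (f ∘ u) (f ∘ v) := by
  simp [pairProd, map_prod]

/-- Evaluation of polynomials at a bit string. -/
def evalBits (x : σ → Fin 2) : MvPolynomial σ ℂ →ₗ[ℂ] ℂ :=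
  (aeval fun i => if x i = 1 then (1 : ℂ) else 0).toLinearMap

theorem evalBits_pairProd (x : σ → Fin 2) {ℓ : ℕ} (u v : Fin ℓ → σ) :
    evalBits x (pairProd u v) =
      ∏ j, ((if x (u j) = 1 then 1 else 0) - (if x (v j) = 1 then 1 else 0)) := by
  simp [evalBits, pairProd, map_prod]

theorem evalBits_rename (x : σ → Fin 2) {f : σ → σ} (hf : x ∘ f = x) (P : MvPolynomial σ ℂ) :
    evalBits x (rename f P) = evalBits x P := by
  have h : (fun i => if x i = 1 then (1 : ℂ) else 0) ∘ f =
      fun i => if x i = 1 then (1 : ℂ) else 0 := by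
    funext i
    simp only [Function.comp_apply]
    rw [show x (f i) = x i from congrFun hf i]
  simp only [evalBits, AlgHom.toLinearMap_apply, aeval_rename, h]

/-- If every factor of `pairProd u v` contains a variable of either colour, the factors can be
oriented. -/
theorem exists_oriented (x : σ → Fin 2) {ℓ : ℕ} {u v : Fin ℓ → σ}
    (h : Function.Injective (Sum.elim u v)) (hx : ∀ j, x (u j) ≠ x (v j)) :
    ∃ u' v' : Fin ℓ → σ, Function.Injective u' ∧ Function.Injective v' ∧ (∀ j, x (u' j) = 1) ∧
      (∀ j, x (v' j) = 0) ∧ pairProd u v = evalBits x (pairProd u v) • pairProd u' v' := by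
  rw [Sum.elim_injective] at h
  obtain ⟨h1, h2, h3⟩ := h
  have hb : ∀ a : Fin 2, a = 0 ∨ a = 1 := by decide
  refine ⟨fun j => if x (u j) = 1 then u j else v j, fun j => if x (u j) = 1 then v j else u j,
    ?_, ?_, ?_, ?_, ?_⟩
  · intro i j hij
    dsimp only at hij
    split_ifs at hij
    exacts [h1 hij, absurd hij (h3 _ _), absurd hij.symm (h3 _ _), h2 hij]
  · intro i j hij
    dsimp only at hij
    split_ifs at hij
    exacts [h2 hij, absurd hij.symm (h3 _ _), absurd hij (h3 _ _), h1 hij]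
  · intro j
    dsimp only
    have := hx j
    rcases hb (x (u j)) with h | h <;> rcases hb (x (v j)) with h' | h' <;> simp_all
  · intro j
    dsimp only
    have := hx j
    rcases hb (x (u j)) with h | h <;> rcases hb (x (v j)) with h' | h' <;> simp_all
  -- A factor takes the value `1` at `x`, or `-1` if it was reversed, so evaluation at `x` records
  -- the total sign.
  · rw [evalBits_pairProd]
    simp only [pairProd]
    rw [← Finset.prod_smul]
    refine Finset.prod_congr rfl fun j _ => ?_
    have := hx j
    rcases hb (x (u j)) with h | h <;> rcases hb (x (v j)) with h' | h' <;> simp_all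

theorem evalBits_pairProd_of_oriented (x : σ → Fin 2) {ℓ : ℕ} {u v : Fin ℓ → σ}
    (hu : ∀ j, x (u j) = 1) (hv : ∀ j, x (v j) = 0) : evalBits x (pairProd u v) = 1 := by
  rw [evalBits_pairProd]
  simp [hu, hv]

theorem evalBits_pairProd_eq_zero (x : σ → Fin 2) {ℓ : ℕ} {u v : Fin ℓ → σ} {j : Fin ℓ}
    (h : x (u j) = x (v j)) : evalBits x (pairProd u v) = 0 := by
  rw [evalBits_pairProd]
  exact Finset.prod_eq_zero (Finset.mem_univ j) (by rw [h, sub_self])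

/-- Extend `u ↦ u'` on the ones of `x` and `v ↦ v'` on the zeros, and glue. -/
theorem exists_perm_of_oriented (x : σ → Fin 2) {ℓ : ℕ} {u v u' v' : Fin ℓ → σ}
    (hu : Function.Injective u) (hv : Function.Injective v) (hu' : Function.Injective u')
    (hv' : Function.Injective v') (hxu : ∀ j, x (u j) = 1) (hxv : ∀ j, x (v j) = 0)
    (hxu' : ∀ j, x (u' j) = 1) (hxv' : ∀ j, x (v' j) = 0) :
    ∃ π : Equiv.Perm σ, x ∘ π = x ∧ π ∘ u = u' ∧ π ∘ v = v' := by
  have hn : ∀ {i}, x i = 0 → ¬ x i = 1 := fun h => by simp [h]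
  have hz : ∀ {i}, ¬ x i = 1 → x i = 0 := fun {i} h => by
    have : ∀ a : Fin 2, a ≠ 1 → a = 0 := by decide
    exact this _ h
  obtain ⟨p, hp⟩ := Equiv.Perm.exists_extending_pair
    (fun j => (⟨u j, hxu j⟩ : {i // x i = 1})) (fun j => ⟨u' j, hxu' j⟩)
    (fun i j h => hu (congrArg Subtype.val h)) (fun i j h => hu' (congrArg Subtype.val h))
  obtain ⟨q, hq⟩ := Equiv.Perm.exists_extending_pair
    (fun j => (⟨v j, hn (hxv j)⟩ : {i // ¬ x i = 1})) (fun j => ⟨v' j, hn (hxv' j)⟩)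
    (fun i j h => hv (congrArg Subtype.val h)) (fun i j h => hv' (congrArg Subtype.val h))
  refine ⟨p.subtypeCongr q, ?_, ?_, ?_⟩
  · funext i
    simp only [Function.comp_apply]
    by_cases hi : x i = 1
    · rw [Equiv.Perm.subtypeCongr.left_apply (p := fun i => x i = 1) p q hi, hi]
      exact (p ⟨i, hi⟩).2
    · rw [Equiv.Perm.subtypeCongr.right_apply (p := fun i => x i = 1) p q hi, hz hi]
      exact hz (q ⟨i, hi⟩).2
  · funext j
    simp only [Function.comp_apply]
    rw [Equiv.Perm.subtypeCongr.left_apply (p := fun i => x i = 1) p q (hxu j), hp]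
  · funext j
    simp only [Function.comp_apply]
    rw [Equiv.Perm.subtypeCongr.right_apply (p := fun i => x i = 1) p q (hn (hxv j)), hq]

theorem card_bit_one [Fintype σ] (x : σ → Fin 2) : Fintype.card {i // x i = 1} = hammingNorm x := by
  rw [Fintype.card_subtype, hammingNorm]
  congr 1
  ext i
  have : ∀ a : Fin 2, a = 1 ↔ a ≠ 0 := by decide
  simp [this (x i)]

theorem card_bit_zero [Fintype σ] (x : σ → Fin 2) :
    Fintype.card {i // x i = 0} = Fintype.card σ - hammingNorm x := by
  rw [← card_bit_one, ← Fintype.card_subtype_compl]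
  refine Fintype.card_congr (Equiv.subtypeEquivRight fun i => ?_)
  have : ∀ a : Fin 2, a = 0 ↔ ¬ a = 1 := by decide
  exact this _

theorem exists_oriented_of_le [Fintype σ] (x : σ → Fin 2) {ℓ : ℕ} (h1 : ℓ ≤ hammingNorm x)
    (h0 : ℓ + hammingNorm x ≤ Fintype.card σ) :
    ∃ u v : Fin ℓ → σ, Function.Injective u ∧ Function.Injective v ∧ (∀ j, x (u j) = 1) ∧
      ∀ j, x (v j) = 0 := by
  obtain ⟨u⟩ := Function.Embedding.nonempty_of_card_le (α := Fin ℓ) (β := {i // x i = 1})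
    (by rw [card_bit_one]; simpa using h1)
  obtain ⟨v⟩ := Function.Embedding.nonempty_of_card_le (α := Fin ℓ) (β := {i // x i = 0})
    (by rw [card_bit_zero, Fintype.card_fin]; omega)
  exact ⟨fun j => u j, fun j => v j, Subtype.val_injective.comp u.injective,
    Subtype.val_injective.comp v.injective, fun j => (u j).2, fun j => (v j).2⟩

variable [Fintype σ] [DecidableEq σ]

/-- The permutations that preserve the bit string `x`. -/
def bitStabilizer (x : σ → Fin 2) : Finset (Equiv.Perm σ) :=
  Finset.univ.filter fun π => x ∘ π = x

theorem mem_bitStabilizer {x : σ → Fin 2} {π : Equiv.Perm σ} :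
    π ∈ bitStabilizer x ↔ x ∘ π = x := by
  simp [bitStabilizer]

/-- The sum over the permutations of the variables that preserve the bit string `x`. -/
def orbitSum (x : σ → Fin 2) : MvPolynomial σ ℂ →ₗ[ℂ] MvPolynomial σ ℂ :=
  ∑ π ∈ bitStabilizer x, (rename π).toLinearMap

theorem orbitSum_apply (x : σ → Fin 2) (P : MvPolynomial σ ℂ) :
    orbitSum x P = ∑ π ∈ bitStabilizer x, rename π P := by
  simp [orbitSum, LinearMap.sum_apply]

theorem orbitSum_rename (x : σ → Fin 2) {τ : Equiv.Perm σ} (hτ : x ∘ τ = x)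
    (P : MvPolynomial σ ℂ) : orbitSum x (rename τ P) = orbitSum x P := by
  rw [orbitSum_apply, orbitSum_apply]
  refine Finset.sum_equiv (Equiv.mulRight τ) ?_ ?_
  · intro π
    simp only [mem_bitStabilizer, Equiv.coe_mulRight, Equiv.Perm.coe_mul]
    constructor
    · intro h
      rw [← Function.comp_assoc, h, hτ]
    · intro h
      rw [← Function.comp_assoc] at h
      refine τ.surjective.injective_comp_right ?_
      exact h.trans hτ.symm
  · intro π _
    simp [rename_rename]

theorem evalBits_orbitSum (x : σ → Fin 2) (P : MvPolynomial σ ℂ) :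
    evalBits x (orbitSum x P) =
      (Fintype.card {π : Equiv.Perm σ // x ∘ π = x} : ℂ) * evalBits x P := by
  rw [orbitSum_apply, map_sum, Finset.sum_congr rfl
    (fun π hπ => evalBits_rename x (mem_bitStabilizer.mp hπ) P), Finset.sum_const, nsmul_eq_mul,
    Fintype.card_subtype]
  rfl

/-- The transposition of `u j` and `v j` preserves `x` and negates the product, so the sum equals
its own negative. -/
theorem orbitSum_pairProd_eq_zero (x : σ → Fin 2) {ℓ : ℕ} {u v : Fin ℓ → σ}
    (h : Function.Injective (Sum.elim u v)) {j : Fin ℓ} (hj : x (u j) = x (v j)) :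
    orbitSum x (pairProd u v) = 0 := by
  rw [Sum.elim_injective] at h
  obtain ⟨h1, h2, h3⟩ := h
  have hx : x ∘ Equiv.swap (u j) (v j) = x := by
    funext i
    simp only [Function.comp_apply, Equiv.swap_apply_def]
    split_ifs with hi hi' <;> simp_all
  have hs : rename (Equiv.swap (u j) (v j)) (pairProd u v) = -pairProd u v := by
    rw [rename_pairProd, pairProd, pairProd, ← Finset.mul_prod_erase _ _ (Finset.mem_univ j),
      ← Finset.mul_prod_erase _ (fun i => (X (u i) - X (v i) : MvPolynomial σ ℂ))
        (Finset.mem_univ j), ← neg_mul, neg_sub]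
    congr 1
    · simp
    · refine Finset.prod_congr rfl fun i hi => ?_
      have hij := Finset.ne_of_mem_erase hi
      simp only [Function.comp_apply]
      rw [Equiv.swap_apply_of_ne_of_ne (fun h => hij (h1 h)) (h3 _ _),
        Equiv.swap_apply_of_ne_of_ne (h3 _ _).symm (fun h => hij (h2 h))]
  have h := orbitSum_rename x hx (pairProd u v)
  rw [hs, map_neg] at h
  exact self_eq_neg.mp h.symm

theorem orbitSum_pairProd (x : σ → Fin 2) {ℓ : ℕ} {u v u' v' : Fin ℓ → σ}
    (h : Function.Injective (Sum.elim u v)) (hu' : Function.Injective u')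
    (hv' : Function.Injective v') (hxu' : ∀ j, x (u' j) = 1) (hxv' : ∀ j, x (v' j) = 0) :
    orbitSum x (pairProd u v) = evalBits x (pairProd u v) • orbitSum x (pairProd u' v') := by
  by_cases hc : ∃ j, x (u j) = x (v j)
  · obtain ⟨j, hj⟩ := hc
    rw [orbitSum_pairProd_eq_zero x h hj, evalBits_pairProd_eq_zero x hj, zero_smul]
  · push Not at hc
    obtain ⟨a, b, ha, hb, hxa, hxb, he⟩ := exists_oriented x h hc
    obtain ⟨π, hπ, hπu, hπv⟩ := exists_perm_of_oriented x ha hb hu' hv' hxa hxb hxu' hxv'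
    rw [← hπu, ← hπv, ← rename_pairProd, orbitSum_rename x hπ, ← map_smul, ← he]

/-- Linear extension of `orbitSum_pairProd`: on the span the symmetrization has rank at most one. -/
theorem orbitSum_of_mem_pairSpan (x : σ → Fin 2) {ℓ : ℕ} {u v : Fin ℓ → σ}
    (hu : Function.Injective u) (hv : Function.Injective v) (hxu : ∀ j, x (u j) = 1)
    (hxv : ∀ j, x (v j) = 0) {P : MvPolynomial σ ℂ} (hP : P ∈ pairSpan Set.univ ℓ) :
    orbitSum x P = evalBits x P • orbitSum x (pairProd u v) := by
  refine LinearMap.eqOn_span (f := orbitSum x)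
    (g := (evalBits x).smulRight (orbitSum x (pairProd u v))) ?_ hP
  rintro _ ⟨a, b, hi, -, -, rfl⟩
  exact orbitSum_pairProd x hi hu hv hxu hxv

/-- A product that is not killed uses a one of `x` in each of its `ℓ` factors. -/
theorem orbitSum_eq_zero_of_mem_pairSpan (x : σ → Fin 2) {ℓ : ℕ} (hℓ : hammingNorm x < ℓ)
    {P : MvPolynomial σ ℂ} (hP : P ∈ pairSpan Set.univ ℓ) : orbitSum x P = 0 := by
  refine LinearMap.eqOn_span (f := orbitSum x) (g := 0) ?_ hP
  rintro _ ⟨a, b, hi, -, -, rfl⟩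
  by_cases hc : ∃ j, x (a j) = x (b j)
  · obtain ⟨j, hj⟩ := hc
    exact orbitSum_pairProd_eq_zero x hi hj
  · push Not at hc
    obtain ⟨u, v, hu, -, hxu, -, -⟩ := exists_oriented x hi hc
    have := Finset.card_le_card_of_injOn (s := Finset.univ)
      (t := Finset.univ.filter fun i => x i ≠ 0) u (by intro j _; simp [hxu]) hu.injOn
    rw [Finset.card_univ, Fintype.card_fin] at this
    exact absurd this (not_le.mpr hℓ)

theorem card_perm_preserving (x : σ → Fin 2) :
    Fintype.card {π : Equiv.Perm σ // x ∘ π = x} =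
      (Fintype.card σ - hammingNorm x).factorial * (hammingNorm x).factorial := by
  rw [DomMulAct.stabilizer_card, Fin.prod_univ_two, card_bit_zero, card_bit_one]

end OrbitSum

/-! ### Two-row Specht modules as spaces of polynomials -/

section Specht

theorem mem_twoRow_cells {n ℓ : ℕ} (h : ℓ ≤ n / 2) (c : ℕ × ℕ) :
    c ∈ (twoRow n ℓ h).1.cells ↔ (c.1 = 0 ∧ c.2 < n - ℓ) ∨ (c.1 = 1 ∧ c.2 < ℓ) := by
  obtain ⟨i, j⟩ := c
  rw [YoungDiagram.mem_cells]
  simp only [twoRow, YoungDiagram.mem_ofRowLens]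
  rcases i with _ | _ | i <;> simp

/-- The box of a two-row diagram, given as a box of one of the columns of length two or as a box of
one of the columns of length one. -/
def twoRowBox {n ℓ : ℕ} (h : ℓ ≤ n / 2) :
    (Fin 2 × Fin ℓ) ⊕ Fin (n - 2 * ℓ) → (twoRow n ℓ h).1.cells
  | .inl p => ⟨(p.1, p.2), by
      rw [mem_twoRow_cells]
      have := p.1.isLt
      have := p.2.isLt
      omega⟩
  | .inr j => ⟨(0, ℓ + j), by
      rw [mem_twoRow_cells]
      have := j.isLt
      omega⟩

theorem twoRowBox_injective {n ℓ : ℕ} (h : ℓ ≤ n / 2) : Function.Injective (twoRowBox h) := by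
  rintro (⟨r, i⟩ | i) (⟨s, j⟩ | j) hij <;>
    simp only [twoRowBox, Subtype.mk.injEq, Prod.mk.injEq] at hij
  · rw [Sum.inl.injEq, Prod.mk.injEq]
    exact ⟨Fin.ext hij.1, Fin.ext hij.2⟩
  · omega
  · omega
  · rw [Sum.inr.injEq]
    exact Fin.ext (by omega)

/-- The boxes of a two-row diagram, sorted into those in columns of length two and those in columns
of length one. -/
def twoRowEquiv {n ℓ : ℕ} (h : ℓ ≤ n / 2) :
    (Fin 2 × Fin ℓ) ⊕ Fin (n - 2 * ℓ) ≃ (twoRow n ℓ h).1.cells :=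
  Equiv.ofBijective (twoRowBox h) <| by
    rw [Fintype.bijective_iff_injective_and_card]
    refine ⟨twoRowBox_injective h, ?_⟩
    have : (twoRow n ℓ h).1.cells.card = n := (twoRow n ℓ h).2
    rw [Fintype.card_coe, this]
    simp
    omega

/-- The entries of `t`, sorted by their boxes. -/
def Tableau.sorted {n ℓ : ℕ} {h : ℓ ≤ n / 2} (t : Tableau (twoRow n ℓ h)) :
    (Fin 2 × Fin ℓ) ⊕ Fin (n - 2 * ℓ) ≃ Fin n :=
  (twoRowEquiv h).trans t.symm

theorem Tableau.row_sorted_inl {n ℓ : ℕ} {h : ℓ ≤ n / 2} (t : Tableau (twoRow n ℓ h))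
    (p : Fin 2 × Fin ℓ) : t.row (t.sorted (.inl p)) = p.1 := by
  simp [Tableau.row, Tableau.sorted, twoRowEquiv, twoRowBox]

theorem Tableau.row_sorted_inr {n ℓ : ℕ} {h : ℓ ≤ n / 2} (t : Tableau (twoRow n ℓ h))
    (j : Fin (n - 2 * ℓ)) : t.row (t.sorted (.inr j)) = 0 := by
  simp [Tableau.row, Tableau.sorted, twoRowEquiv, twoRowBox]

theorem Tableau.col_sorted_inl {n ℓ : ℕ} {h : ℓ ≤ n / 2} (t : Tableau (twoRow n ℓ h))
    (p : Fin 2 × Fin ℓ) : t.col (t.sorted (.inl p)) = p.2 := by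
  simp [Tableau.col, Tableau.sorted, twoRowEquiv, twoRowBox]

theorem Tableau.col_sorted_inr {n ℓ : ℕ} {h : ℓ ≤ n / 2} (t : Tableau (twoRow n ℓ h))
    (j : Fin (n - 2 * ℓ)) : t.col (t.sorted (.inr j)) = ℓ + j := by
  simp [Tableau.col, Tableau.sorted, twoRowEquiv, twoRowBox]

theorem Tableau.row_lt_two {n ℓ : ℕ} {h : ℓ ≤ n / 2} (t : Tableau (twoRow n ℓ h)) (i : Fin n) :
    t.row i < 2 := by
  have := (mem_twoRow_cells h _).mp (t i).2
  unfold Tableau.row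
  omega

/-- The functions `Fin n → ℕ` with values in `{0, 1}`. -/
def bitFunctions (n : ℕ) : Finset (Fin n → ℕ) := Fintype.piFinset fun _ => Finset.range 2

theorem mem_bitFunctions {n : ℕ} {r : Fin n → ℕ} : r ∈ bitFunctions n ↔ ∀ i, r i < 2 := by
  simp [bitFunctions]

/-- The multilinear polynomial whose coefficients are the values of a function at bit strings. -/
def bitPoly (n : ℕ) : ((Fin n → ℕ) → ℂ) →ₗ[ℂ] MvPolynomial (Fin n) ℂ :=
  ∑ r ∈ bitFunctions n, monomial (Finsupp.equivFunOnFinite.symm r) ∘ₗ LinearMap.proj r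

theorem bitPoly_apply {n : ℕ} (f : (Fin n → ℕ) → ℂ) :
    bitPoly n f = ∑ r ∈ bitFunctions n, monomial (Finsupp.equivFunOnFinite.symm r) (f r) := by
  simp [bitPoly, LinearMap.sum_apply]

theorem coeff_bitPoly {n : ℕ} (f : (Fin n → ℕ) → ℂ) {r : Fin n → ℕ} (hr : r ∈ bitFunctions n) :
    coeff (Finsupp.equivFunOnFinite.symm r) (bitPoly n f) = f r := by
  rw [bitPoly_apply, coeff_sum]
  simp [coeff_monomial, hr]

theorem bitPoly_single {n : ℕ} {r : Fin n → ℕ} (hr : ∀ i, r i < 2) :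
    bitPoly n (Pi.single r 1) = ∏ i, X i ^ r i := by
  rw [bitPoly_apply, Finset.sum_eq_single_of_mem r (mem_bitFunctions.mpr hr), Pi.single_eq_same,
    monomial_eq]
  · rw [Finsupp.prod_fintype _ _ (by simp)]
    simp
  · intro s _ hs
    rw [Pi.single_eq_of_ne hs, map_zero]

theorem bitPoly_permRep {n : ℕ} (π : Equiv.Perm (Fin n)) (f : (Fin n → ℕ) → ℂ) :
    bitPoly n (permRep n ℕ π f) = rename π (bitPoly n f) := by
  rw [bitPoly_apply, bitPoly_apply, map_sum]
  -- The value of `permRep n ℕ π f` at `r` is `f (r ∘ π)`, so the monomials are reindexed by `r ↦ r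
  -- ∘ π`.
  refine Finset.sum_equiv (Equiv.arrowCongr π.symm (Equiv.refl ℕ)) ?_ ?_
  · intro r
    simp only [mem_bitFunctions]
    exact ⟨fun h i => h _, fun h i => by simpa using h (π⁻¹ i)⟩
  · intro r _
    rw [rename_monomial]
    congr 2
    ext i
    have : i = π (π.symm i) := by simp
    rw [this, Finsupp.mapDomain_apply π.injective]
    simp

theorem polytabloid_apply_eq_zero {n ℓ : ℕ} {h : ℓ ≤ n / 2} (t : Tableau (twoRow n ℓ h))
    {r : Fin n → ℕ} (hr : r ∉ bitFunctions n) : polytabloid t r = 0 := by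
  rw [polytabloid, Finset.sum_apply]
  refine Finset.sum_eq_zero fun π _ => ?_
  rw [permRep_single, Pi.smul_apply, Pi.single_eq_of_ne, smul_zero]
  rintro rfl
  exact hr (mem_bitFunctions.mpr fun i => t.row_lt_two _)

theorem apply_eq_zero_of_mem_spechtSpace {n ℓ : ℕ} {h : ℓ ≤ n / 2} {f : (Fin n → ℕ) → ℂ}
    (hf : f ∈ spechtSpace (twoRow n ℓ h)) {r : Fin n → ℕ} (hr : r ∉ bitFunctions n) : f r = 0 := by
  have : spechtSpace (twoRow n ℓ h) ≤
      LinearMap.ker (LinearMap.proj r : ((Fin n → ℕ) → ℂ) →ₗ[ℂ] ℂ) := by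
    refine Submodule.span_le.mpr ?_
    rintro _ ⟨t, rfl⟩
    exact polytabloid_apply_eq_zero t hr
  exact this hf

theorem bitPoly_injOn_spechtSpace {n ℓ : ℕ} (h : ℓ ≤ n / 2) :
    Function.Injective ((bitPoly n).domRestrict (spechtSpace (twoRow n ℓ h))) := by
  rintro ⟨f, hf⟩ ⟨g, hg⟩ hfg
  change bitPoly n f = bitPoly n g at hfg
  rw [Subtype.mk.injEq]
  funext r
  by_cases hr : r ∈ bitFunctions n
  · rw [← coeff_bitPoly f hr, hfg, coeff_bitPoly g hr]
  · rw [apply_eq_zero_of_mem_spechtSpace hf hr, apply_eq_zero_of_mem_spechtSpace hg hr]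

/-- The matrix whose determinant is the polynomial of a polytabloid. -/
def Tableau.colMatrix {n : ℕ} {μ : Shape n} (t : Tableau μ) :
    Matrix (Fin n) (Fin n) (MvPolynomial (Fin n) ℂ) :=
  Matrix.of fun a i => if t.col a = t.col i then X a ^ t.row i else 0

/-- This is the Leibniz expansion: a permutation that moves an entry to another column meets a zero
of the matrix. -/
theorem bitPoly_polytabloid_eq_det {n ℓ : ℕ} {h : ℓ ≤ n / 2} (t : Tableau (twoRow n ℓ h)) :
    bitPoly n (polytabloid t) = t.colMatrix.det := by
  rw [Matrix.det_apply', polytabloid, map_sum, Finset.sum_filter]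
  refine Finset.sum_congr rfl fun π _ => ?_
  split_ifs with hπ
  · rw [map_smul, bitPoly_permRep, bitPoly_single t.row_lt_two, map_prod, Algebra.smul_def]
    congr 1
    simp only [map_pow, rename_X]
    exact Finset.prod_congr rfl fun i _ => by simp [Tableau.colMatrix, hπ i]
  · push Not at hπ
    obtain ⟨i, hi⟩ := hπ
    rw [Finset.prod_eq_zero (Finset.mem_univ i), mul_zero]
    simp [Tableau.colMatrix, hi]

theorem bitPoly_polytabloid {n ℓ : ℕ} {h : ℓ ≤ n / 2} (t : Tableau (twoRow n ℓ h)) :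
    bitPoly n (polytabloid t) =
      pairProd (fun j => t.sorted (.inl (1, j))) (fun j => t.sorted (.inl (0, j))) := by
  -- Sorted by columns, the matrix has a 2 × 2 Vandermonde block for each column of length two and
  -- the entry 1 for each column of length one.
  have hM : t.colMatrix.submatrix t.sorted t.sorted = Matrix.fromBlocks
      (Matrix.blockDiagonal fun j => !![1, X (t.sorted (.inl (0, j)));
        1, X (t.sorted (.inl (1, j)))]) 0 0 1 := by
    ext1 a b
    rcases a with ⟨r, i⟩ | i <;> rcases b with ⟨s, j⟩ | j
    · simp only [Matrix.submatrix_apply, Tableau.colMatrix, Matrix.of_apply,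
        Tableau.col_sorted_inl, Tableau.row_sorted_inl, Matrix.fromBlocks_apply₁₁,
        Matrix.blockDiagonal_apply, Fin.val_inj]
      split_ifs with hij
      · subst hij
        fin_cases r <;> fin_cases s <;> simp
      · rfl
    · simp only [Matrix.submatrix_apply, Tableau.colMatrix, Matrix.of_apply,
        Tableau.col_sorted_inl, Tableau.col_sorted_inr, Matrix.fromBlocks_apply₁₂]
      rw [if_neg (by omega)]
      rfl
    · simp only [Matrix.submatrix_apply, Tableau.colMatrix, Matrix.of_apply,
        Tableau.col_sorted_inl, Tableau.col_sorted_inr, Matrix.fromBlocks_apply₂₁]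
      rw [if_neg (by omega)]
      rfl
    · simp only [Matrix.submatrix_apply, Tableau.colMatrix, Matrix.of_apply,
        Tableau.col_sorted_inr, Tableau.row_sorted_inr, Matrix.fromBlocks_apply₂₂,
        Matrix.one_apply, pow_zero, add_right_inj, Fin.val_inj]
  rw [bitPoly_polytabloid_eq_det, ← Matrix.det_submatrix_equiv_self t.sorted, hM,
    Matrix.det_fromBlocks_zero₂₁, Matrix.det_blockDiagonal, Matrix.det_one, mul_one, pairProd]
  refine Finset.prod_congr rfl fun j _ => ?_
  rw [Matrix.det_fin_two_of]
  ring

theorem Tableau.sorted_pairs_injective {n ℓ : ℕ} {h : ℓ ≤ n / 2} (t : Tableau (twoRow n ℓ h)) :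
    Function.Injective (Sum.elim (fun j => t.sorted (.inl (1, j)))
      (fun j => t.sorted (.inl (0, j)))) := by
  rw [Sum.elim_injective]
  refine ⟨fun i j hij => ?_, fun i j hij => ?_, fun i j hij => ?_⟩
  · simpa using hij
  · simpa using hij
  · simp at hij

theorem map_bitPoly_spechtSpace {n ℓ : ℕ} (h : ℓ ≤ n / 2) :
    (spechtSpace (twoRow n ℓ h)).map (bitPoly n) = pairSpan Set.univ ℓ := by
  refine le_antisymm ?_ ?_
  · rw [spechtSpace, Submodule.map_span, Submodule.span_le]
    rintro _ ⟨_, ⟨t, rfl⟩, rfl⟩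
    change bitPoly n (polytabloid t) ∈ _
    rw [bitPoly_polytabloid]
    exact pairProd_mem_pairSpan t.sorted_pairs_injective (fun _ => trivial) fun _ => trivial
  · refine Submodule.span_le.mpr ?_
    rintro _ ⟨u, v, hi, -, -, rfl⟩
    let t : Tableau (twoRow n ℓ h) := Fintype.equivOfCardEq (by
      have : (twoRow n ℓ h).1.cells.card = n := (twoRow n ℓ h).2
      rw [Fintype.card_coe, this, Fintype.card_fin])
    -- Any choice of disjoint pairs arises by permuting the entries of one fixed tableau.
    obtain ⟨π, hπ⟩ := Equiv.Perm.exists_extending_pair _ _ t.sorted_pairs_injective hi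
    refine ⟨permRep n ℕ π (polytabloid t), permRep_mem_spechtSpace _ _ _
      (Submodule.subset_span ⟨t, rfl⟩), ?_⟩
    rw [bitPoly_permRep, bitPoly_polytabloid, rename_pairProd]
    congr 1
    · funext j
      exact hπ (.inl j)
    · funext j
      exact hπ (.inr j)

theorem bitPoly_mem_pairSpan {n ℓ : ℕ} {h : ℓ ≤ n / 2} (f : spechtSpace (twoRow n ℓ h)) :
    bitPoly n f ∈ pairSpan Set.univ ℓ := by
  rw [← map_bitPoly_spechtSpace h]
  exact Submodule.mem_map_of_mem f.2

theorem finrank_spechtSpace_eq {n ℓ : ℕ} (h : ℓ ≤ n / 2) :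
    Module.finrank ℂ (spechtSpace (twoRow n ℓ h)) =
      Module.finrank ℂ (pairSpan (Set.univ : Set (Fin n)) ℓ) := by
  rw [← map_bitPoly_spechtSpace h, ← LinearMap.range_domRestrict]
  exact (LinearMap.finrank_range_of_inj (bitPoly_injOn_spechtSpace h)).symm

/-- The dimension of the Specht module of shape `(n - ℓ, ℓ)`. -/
theorem finrank_spechtSpace {n ℓ : ℕ} (h : ℓ ≤ n / 2) :
    (Module.finrank ℂ (spechtSpace (twoRow n ℓ h)) : ℂ) =
      (n.choose ℓ : ℂ) - (if ℓ = 0 then 0 else (n.choose (ℓ - 1) : ℂ)) := by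
  rw [finrank_spechtSpace_eq]
  rcases ℓ with _ | ℓ
  · simp [finrank_pairSpan_zero]
  · have := finrank_pairSpan_succ (Finset.univ : Finset (Fin n)) ℓ (by simp; omega)
    rw [Finset.coe_univ, Finset.card_univ, Fintype.card_fin] at this
    rw [← this]
    simp

instance spechtSpace_finiteDimensional {n ℓ : ℕ} (h : ℓ ≤ n / 2) :
    FiniteDimensional ℂ (spechtSpace (twoRow n ℓ h)) := by
  exact FiniteDimensional.span_of_finite ℂ (Set.finite_range _)

/-- The sum of the operators of the permutations that preserve `x` in the Specht module. -/
def spechtOrbitSum {n ℓ : ℕ} (h : ℓ ≤ n / 2) (x : Fin n → Fin 2) :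
    spechtSpace (twoRow n ℓ h) →ₗ[ℂ] spechtSpace (twoRow n ℓ h) :=
  ∑ π ∈ bitStabilizer x, spechtRep (twoRow n ℓ h) π

theorem bitPoly_spechtOrbitSum {n ℓ : ℕ} (h : ℓ ≤ n / 2) (x : Fin n → Fin 2)
    (f : spechtSpace (twoRow n ℓ h)) :
    bitPoly n (spechtOrbitSum h x f) = orbitSum x (bitPoly n f) := by
  rw [spechtOrbitSum, orbitSum_apply, LinearMap.sum_apply, Submodule.coe_sum, map_sum]
  exact Finset.sum_congr rfl fun π _ => bitPoly_permRep π _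

theorem sum_character {n ℓ : ℕ} (h : ℓ ≤ n / 2) (x : Fin n → Fin 2) :
    ∑ π ∈ bitStabilizer x, (spechtRep (twoRow n ℓ h)).character π =
      LinearMap.trace ℂ _ (spechtOrbitSum h x) := by
  rw [spechtOrbitSum, map_sum]
  rfl

theorem sum_character_of_lt {n ℓ : ℕ} (h : ℓ ≤ n / 2) (x : Fin n → Fin 2)
    (hx : hammingNorm x < ℓ) :
    ∑ π ∈ bitStabilizer x, (spechtRep (twoRow n ℓ h)).character π = 0 := by
  have : spechtOrbitSum h x = 0 := by
    ext1 f
    apply bitPoly_injOn_spechtSpace h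
    change bitPoly n (spechtOrbitSum h x f) = bitPoly n 0
    rw [bitPoly_spechtOrbitSum, orbitSum_eq_zero_of_mem_pairSpan x hx (bitPoly_mem_pairSpan f),
      map_zero]
  rw [sum_character, this, map_zero]

/-- The trace of a rank-one operator `g ↦ φ(g) • w` is `φ(w)`. Here `φ` is evaluation at `x` and `w`
the symmetrization of a product with value 1 at `x`, so the trace is the order of the stabilizer. -/
theorem sum_character_of_le {n ℓ : ℕ} (h : ℓ ≤ n / 2) (x : Fin n → Fin 2)
    (hx : ℓ ≤ hammingNorm x) (hn : hammingNorm x ≤ n / 2) :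
    ∑ π ∈ bitStabilizer x, (spechtRep (twoRow n ℓ h)).character π =
      ((n - hammingNorm x).factorial * (hammingNorm x).factorial : ℕ) := by
  obtain ⟨u, v, hu, hv, hxu, hxv⟩ := exists_oriented_of_le x hx (by rw [Fintype.card_fin]; omega)
  have hi : Function.Injective (Sum.elim u v) := by
    rw [Sum.elim_injective]
    refine ⟨hu, hv, fun i j hij => ?_⟩
    have := hxu i
    rw [hij, hxv j] at this
    exact zero_ne_one this
  have hmem : pairProd u v ∈ (spechtSpace (twoRow n ℓ h)).map (bitPoly n) := by
    rw [map_bitPoly_spechtSpace h]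
    exact pairProd_mem_pairSpan hi (fun _ => trivial) fun _ => trivial
  obtain ⟨f, hf, hfuv⟩ := hmem
  have hT : spechtOrbitSum h x = LinearMap.smulRight
      (evalBits x ∘ₗ (bitPoly n).domRestrict (spechtSpace (twoRow n ℓ h)))
      (spechtOrbitSum h x ⟨f, hf⟩) := by
    ext1 g
    apply bitPoly_injOn_spechtSpace h
    change bitPoly n (spechtOrbitSum h x g) =
      bitPoly n (evalBits x (bitPoly n g) • (spechtOrbitSum h x ⟨f, hf⟩ : (Fin n → ℕ) → ℂ))
    rw [map_smul, bitPoly_spechtOrbitSum, bitPoly_spechtOrbitSum, hfuv]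
    exact orbitSum_of_mem_pairSpan x hu hv hxu hxv (bitPoly_mem_pairSpan g)
  rw [sum_character, hT, LinearMap.trace_smulRight]
  change evalBits x (bitPoly n (spechtOrbitSum h x ⟨f, hf⟩)) = _
  rw [bitPoly_spechtOrbitSum, hfuv, evalBits_orbitSum, evalBits_pairProd_of_oriented x hxu hxv,
    card_perm_preserving, mul_one, Fintype.card_fin]

end Specht

/-! ### Outcome probabilities -/

section Outcome

theorem outcomeProb_ketBra {n : ℕ} (μ : Shape n) (x : Fin n → Fin 2) :
    outcomeProb μ (ketBra x) = (Module.finrank ℂ (spechtSpace μ) : ℂ) / (n.factorial : ℂ) *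
      ∑ π ∈ bitStabilizer x, (spechtRep μ).character π := by
  -- Rank one again: the trace is the diagonal entry of the projector at `x`.
  have hcomp : schurProjector μ ∘ₗ ketBra x =
      (LinearMap.proj x : Qubits n →ₗ[ℂ] ℂ).smulRight (schurProjector μ (Pi.single x 1)) := by
    refine LinearMap.ext fun v => ?_
    have hv : ketBra x v = v x • Pi.single x (1 : ℂ) := by
      rw [← Pi.single_smul, smul_eq_mul, mul_one]
      rfl
    rw [LinearMap.comp_apply, hv, map_smul]
    rfl
  rw [outcomeProb, hcomp, LinearMap.trace_smulRight, schurProjector, LinearMap.smul_apply,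
    LinearMap.sum_apply, LinearMap.proj_apply, Pi.smul_apply, Finset.sum_apply, smul_eq_mul,
    bitStabilizer, Finset.sum_filter]
  congr 1
  refine Finset.sum_congr rfl fun π _ => ?_
  change (spechtRep μ).character π * (Pi.single x 1 : (Fin n → Fin 2) → ℂ) (x ∘ π) = _
  rw [Pi.single_apply, mul_ite, mul_one, mul_zero]

theorem outcomeProb_of_le {n ℓ : ℕ} (h : ℓ ≤ n / 2) (x : Fin n → Fin 2)
    (hx : ℓ ≤ hammingNorm x) (hn : hammingNorm x ≤ n / 2) :
    outcomeProb (twoRow n ℓ h) (ketBra x) =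
      ((n.choose ℓ : ℂ) - (if ℓ = 0 then 0 else (n.choose (ℓ - 1) : ℂ))) /
        (n.choose (hammingNorm x) : ℂ) := by
  rw [outcomeProb_ketBra, finrank_spechtSpace, sum_character_of_le h x hx hn]
  have hc := Nat.choose_mul_factorial_mul_factorial (show hammingNorm x ≤ n by omega)
  have hpos : (n.choose (hammingNorm x) : ℂ) ≠ 0 :=
    Nat.cast_ne_zero.mpr (Nat.choose_pos (by omega)).ne'
  have hfac : (n.factorial : ℂ) ≠ 0 := Nat.cast_ne_zero.mpr n.factorial_ne_zero
  rw [div_mul_eq_mul_div, div_eq_div_iff hfac hpos, ← hc]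
  push_cast
  ring

/-- The sum telescopes. The `if` supplies the value 0 at `ℓ = 0`, where truncated subtraction would
give `n.choose 0 = 1`. -/
theorem sum_choose_sub_choose (n m : ℕ) :
    ∑ ℓ ∈ Finset.range (m + 1),
      ((n.choose ℓ : ℂ) - (if ℓ = 0 then 0 else (n.choose (ℓ - 1) : ℂ))) = n.choose m := by
  induction m with
  | zero => simp
  | succ m ih =>
    rw [Finset.sum_range_succ, ih]
    simp

end Outcome

end

end WeakSchur

theorem lemma1 (n k : ℕ) (hk : k ≤ n / 2) (x : Fin n → Fin 2) (hx : hammingNorm x = k) :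
    (∀ (ℓ : ℕ) (hℓ : ℓ ≤ n / 2), k < ℓ →
      WeakSchur.outcomeProb (WeakSchur.twoRow n ℓ hℓ) (WeakSchur.ketBra x) = 0) ∧
    (∀ (ℓ : ℕ) (hℓ : ℓ ≤ n / 2), ℓ ≤ k →
      WeakSchur.outcomeProb (WeakSchur.twoRow n ℓ hℓ) (WeakSchur.ketBra x) =
        ((n.choose ℓ : ℂ) - (if ℓ = 0 then 0 else (n.choose (ℓ - 1) : ℂ))) /
          (n.choose k : ℂ)) ∧
    ∑ ℓ : Fin (k + 1),
      WeakSchur.outcomeProb (WeakSchur.twoRow n (ℓ : ℕ) ((Nat.le_of_lt_succ ℓ.isLt).trans hk))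
        (WeakSchur.ketBra x) = 1 := by
  subst hx
  refine ⟨fun ℓ hℓ hlt => ?_, fun ℓ hℓ hle => WeakSchur.outcomeProb_of_le hℓ x hle hk, ?_⟩
  · rw [WeakSchur.outcomeProb_ketBra, WeakSchur.sum_character_of_lt hℓ x hlt, mul_zero]
  · rw [Finset.sum_congr rfl fun ℓ _ =>
      WeakSchur.outcomeProb_of_le _ x (Nat.le_of_lt_succ ℓ.isLt) hk, ← Finset.sum_div,
      Fin.sum_univ_eq_sum_range (fun ℓ => (n.choose ℓ : ℂ) -
        (if ℓ = 0 then 0 else (n.choose (ℓ - 1) : ℂ))), WeakSchur.sum_choose_sub_choose]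
    exact div_self (Nat.cast_ne_zero.mpr (Nat.choose_pos (by omega)).ne')
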